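/- Let $\mathcal L$ be the twisted Heisenberg–Virasoro algebra: the complex Lie algebra with basis $d_n, I_n$ ($n\in\mathbb Z$), $z_1,z_2,z_3$ and brackets $$[d_n,d_m]=(m-n)d_{m+n}+\delta_{n,-m}\tfrac{n^3-n}{12}z_1,\qquad [d_n,I_m]=mI_{m+n}+\delta_{n,-m}(n^2+n)z_2,\qquad [I_n,I_m]=n\,\delta_{n,-m}z_3,$$ with $z_1,z_2,z_3$ central. Let $\mathcal H\subset\mathcal L$ be the Heisenberg subalgebra with basis $I_n$ ($n\in\mathbb Z$), $z_3$, graded by $\deg I_n=n$, $\deg z_3=0$. Let $\mathcal O_{\mathcal H}$ be the category of $\mathcal H$-modules $V$ such that for every $v\in V$ there is a positive integer $n$ with $I_iv=0$ for all $i\ge n$. Theorem. Let $\dot z_2,\dot z_3\in\mathbb C$ with $\dot z_3\neq 0$, and let $H\in\mathcal O_{\mathcal H}$ be a simple $\mathcal H$-module on which $z_3$ acts as the scalar $\dot z_3$. For $i,j\in\mathbb Z$ put $:I_iI_j:\,=I_iI_j$ if $i<j$ and $:I_iI_j:\,=I_jI_i$ otherwise. Then for every $k\in\mathbb Z$ and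 $v\in H$ only finitely many of the vectors $:I_{-i}I_{i+k}:v$ ($i\in\mathbb Z$) are nonzero, and the $\mathcal H$-module structure on $H$ extends to a (necessarily unique) $\mathcal L$-module structure on $H$ such that $z_1,z_2,z_3$ act as the scalars $1-\frac{12\dot z_2^2}{\dot z_3}$, $\dot z_2$, $\dot z_3$ and $$d_k=-\frac{1}{2\dot z_3}\sum_{i\in\mathbb Z}:I_{-i}I_{i+k}:+\frac{(k+1)\dot z_2}{\dot z_3}I_k\qquad\text{for all }k\in\mathbb Z.$$ -/

import Mathlib

/- `Module.End ℂ V` with the commutator bracket, as in Mathlib's Lie algebra library. -/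
attribute [local instance] LieRing.ofAssociativeRing

set_option linter.unusedSimpArgs false

/-- Labels of the basis `d_n, I_n (n ∈ ℤ), z_1, z_2, z_3` of the twisted Heisenberg–Virasoro
algebra. -/
inductive HVIndex : Type where
  | d (n : ℤ)
  | I (n : ℤ)
  | z1
  | z2
  | z3

/-- The underlying vector space of the twisted Heisenberg–Virasoro algebra: the complex vector
space with basis `d_n, I_n (n ∈ ℤ), z_1, z_2, z_3`, where `d_n = t^{n+1} d/dt`, `I_n = t^n`. -/
def HVAlgebra : Type := HVIndex →₀ ℂ

namespace HVAlgebra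

noncomputable section

instance : AddCommGroup HVAlgebra := inferInstanceAs (AddCommGroup (HVIndex →₀ ℂ))

instance : Module ℂ HVAlgebra := inferInstanceAs (Module ℂ (HVIndex →₀ ℂ))

/-- The defining basis. -/
def basis : Module.Basis HVIndex ℂ HVAlgebra :=
  (Finsupp.basisSingleOne : Module.Basis HVIndex ℂ (HVIndex →₀ ℂ))

/-- `d_n = t^{n+1} d/dt`. -/
def d (n : ℤ) : HVAlgebra := basis (.d n)

/-- `I_n = t^n`. -/
def I (n : ℤ) : HVAlgebra := basis (.I n)

/-- The central element `z_1`. -/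
def z1 : HVAlgebra := basis .z1

/-- The central element `z_2`. -/
def z2 : HVAlgebra := basis .z2

/-- The central element `z_3`. -/
def z3 : HVAlgebra := basis .z3

/-- The Lie bracket of two basis vectors:
* `[d_n, d_m] = (m - n) d_{m+n} + δ_{n,-m} (n³ - n)/12 z_1`,
* `[d_n, I_m] = m I_{m+n} + δ_{n,-m} (n² + n) z_2`,
* `[I_n, I_m] = n δ_{n,-m} z_3`,
* `z_1, z_2, z_3` are central. -/
def basisBracket : HVIndex → HVIndex → HVAlgebra
  | .d n, .d m => ((m : ℂ) - n) • d (m + n) +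
      (if n = -m then ((n : ℂ) ^ 3 - n) / 12 else 0) • z1
  | .d n, .I m => (m : ℂ) • I (m + n) + (if n = -m then (n : ℂ) ^ 2 + n else 0) • z2
  | .I m, .d n => -((m : ℂ) • I (m + n) + (if n = -m then (n : ℂ) ^ 2 + n else 0) • z2)
  | .I n, .I m => (if n = -m then (n : ℂ) else 0) • z3
  | _, _ => 0

/-- The bilinear extension of `basisBracket`. -/
def bracketBilin : HVAlgebra →ₗ[ℂ] HVAlgebra →ₗ[ℂ] HVAlgebra :=
  basis.constr ℂ fun a => basis.constr ℂ fun b => basisBracket a b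

theorem bracketBilin_basis (a b : HVIndex) :
    bracketBilin (basis a) (basis b) = basisBracket a b := by
  simp [bracketBilin]

theorem basisBracket_swap (a b : HVIndex) : basisBracket a b = -basisBracket b a := by
  cases a with
  | d n =>
    cases b with
    | d m =>
      simp only [basisBracket, neg_add, ← neg_smul, add_comm n m]
      congr 2
      · ring
      · by_cases h : n = -m
        · subst h; simp; ring
        · have h' : ¬ m = -n := by omega
          simp [h, h']
    | _ => simp [basisBracket]
  | I n =>
    cases b with
    | I m =>
      simp only [basisBracket, ← neg_smul]
      congr 1
      by_cases h : n = -m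
      · subst h; simp
      · have h' : ¬ m = -n := by omega
        simp [h, h']
    | _ => simp [basisBracket]
  | _ => cases b <;> simp [basisBracket]

theorem bracketBilin_swap (x y : HVAlgebra) : bracketBilin x y = -bracketBilin y x := by
  have h : bracketBilin = -bracketBilin.flip := by
    refine basis.ext fun a => basis.ext fun b => ?_
    simpa [bracketBilin_basis] using basisBracket_swap a b
  simpa using congrArg (fun f => f x y) h

theorem bracketBilin_z1 (x : HVAlgebra) : bracketBilin x z1 = 0 := by
  have h : bracketBilin.flip z1 = 0 := by
    refine basis.ext fun a => ?_
    cases a <;> simp [z1, bracketBilin_basis, basisBracket]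
  simpa using congrArg (fun f => f x) h

theorem bracketBilin_z2 (x : HVAlgebra) : bracketBilin x z2 = 0 := by
  have h : bracketBilin.flip z2 = 0 := by
    refine basis.ext fun a => ?_
    cases a <;> simp [z2, bracketBilin_basis, basisBracket]
  simpa using congrArg (fun f => f x) h

theorem bracketBilin_z3 (x : HVAlgebra) : bracketBilin x z3 = 0 := by
  have h : bracketBilin.flip z3 = 0 := by
    refine basis.ext fun a => ?_
    cases a <;> simp [z3, bracketBilin_basis, basisBracket]
  simpa using congrArg (fun f => f x) h

theorem bracketBilin_d_d (n m : ℤ) : bracketBilin (d n) (d m) = ((m : ℂ) - n) • d (m + n) +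
    (if n = -m then ((n : ℂ) ^ 3 - n) / 12 else 0) • z1 := bracketBilin_basis _ _

theorem bracketBilin_d_I (n m : ℤ) : bracketBilin (d n) (I m) = (m : ℂ) • I (m + n) +
    (if n = -m then (n : ℂ) ^ 2 + n else 0) • z2 := bracketBilin_basis _ _

theorem bracketBilin_I_I (n m : ℤ) : bracketBilin (I n) (I m) =
    (if n = -m then (n : ℂ) else 0) • z3 := bracketBilin_basis _ _

theorem bracketBilin_I_d (m n : ℤ) : bracketBilin (I m) (d n) =
    -((m : ℂ) • I (m + n) + (if n = -m then (n : ℂ) ^ 2 + n else 0) • z2) :=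
  bracketBilin_basis _ _

theorem bracketBilin_z1_left (x : HVAlgebra) : bracketBilin z1 x = 0 := by
  rw [bracketBilin_swap, bracketBilin_z1, neg_zero]

theorem bracketBilin_z2_left (x : HVAlgebra) : bracketBilin z2 x = 0 := by
  rw [bracketBilin_swap, bracketBilin_z2, neg_zero]

theorem bracketBilin_z3_left (x : HVAlgebra) : bracketBilin z3 x = 0 := by
  rw [bracketBilin_swap, bracketBilin_z3, neg_zero]

theorem jacobi_basis (a b c : HVIndex) :
    bracketBilin (basis a) (bracketBilin (basis b) (basis c)) =
      bracketBilin (bracketBilin (basis a) (basis b)) (basis c) +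
        bracketBilin (basis b) (bracketBilin (basis a) (basis c)) := by
  have hd : ∀ n, basis (.d n) = d n := fun _ => rfl
  have hI : ∀ n, basis (.I n) = I n := fun _ => rfl
  have h1 : basis .z1 = z1 := rfl
  have h2 : basis .z2 = z2 := rfl
  have h3 : basis .z3 = z3 := rfl
  cases a <;> cases b <;> cases c <;>
    simp only [hd, hI, h1, h2, h3, bracketBilin_d_d, bracketBilin_d_I, bracketBilin_I_I,
      bracketBilin_I_d, bracketBilin_z1, bracketBilin_z2, bracketBilin_z3,
      bracketBilin_z1_left, bracketBilin_z2_left, bracketBilin_z3_left, map_add, map_smul,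
      map_neg, map_zero, LinearMap.add_apply, LinearMap.smul_apply, LinearMap.neg_apply,
      LinearMap.zero_apply, smul_zero, add_zero, zero_add, neg_zero]
  all_goals
    rename_i n m k
    have e1 : k + m + n = n + m + k := by ring
    have e2 : k + (m + n) = n + m + k := by ring
    have e3 : k + n + m = n + m + k := by ring
    have e4 : m + (n + k) = n + m + k := by ring
    have e5 : m + n + k = n + m + k := by ring
    have e6 : m + (k + n) = n + m + k := by ring
    have e7 : n + (m + k) = n + m + k := by ring
    have e8 : n + (k + m) = n + m + k := by ring
    have e9 : n + k + m = n + m + k := by ring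
    have e10 : m + k + n = n + m + k := by ring
    have e11 : k + (n + m) = n + m + k := by ring
    have c1 : n = -(k + m) ↔ n + m + k = 0 := by omega
    have c2 : n = -(m + k) ↔ n + m + k = 0 := by omega
    have c3 : m = -(k + n) ↔ n + m + k = 0 := by omega
    have c4 : m = -(n + k) ↔ n + m + k = 0 := by omega
    have c5 : m + n = -k ↔ n + m + k = 0 := by omega
    have c6 : n + m = -k ↔ n + m + k = 0 := by omega
    have c7 : k = -(m + n) ↔ n + m + k = 0 := by omega
    have c8 : k = -(n + m) ↔ n + m + k = 0 := by omega
    have c9 : k + n = -m ↔ n + m + k = 0 := by omega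
    have c10 : k + m = -n ↔ n + m + k = 0 := by omega
    try simp only [e1, e2, e3, e4, e5, e6, e7, e8, e9, e10, e11]
    try simp only [c1, c2, c3, c4, c5, c6, c7, c8, c9, c10]
    by_cases h : n + m + k = 0
    · have hn : (n : ℂ) = -m - k := by
        have : n = -m - k := by omega
        rw [this]
        push_cast
        ring
      try simp only [h, if_true]
      push_cast
      try simp only [hn]
      module
    · try simp only [h, if_false]
      push_cast
      module

theorem basis_induction {p : HVAlgebra → Prop} (x : HVAlgebra)
    (smul_basis : ∀ (r : ℂ) (a : HVIndex), p (r • basis a)) (zero : p 0)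
    (add : ∀ x y, p x → p y → p (x + y)) : p x := by
  rw [← basis.linearCombination_repr x, Finsupp.linearCombination_apply]
  exact Finset.sum_induction _ p add zero fun a _ => smul_basis _ a

theorem bracketBilin_jacobi (x y z : HVAlgebra) :
    bracketBilin x (bracketBilin y z) =
      bracketBilin (bracketBilin x y) z + bracketBilin y (bracketBilin x z) := by
  induction x using basis_induction with
  | smul_basis r a =>
    induction y using basis_induction with
    | smul_basis s b =>
      induction z using basis_induction with
      | smul_basis t c =>
        simp only [map_smul, LinearMap.smul_apply, jacobi_basis a b c]
        module
      | zero => simp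
      | add z z' h h' => simp only [map_add, h, h']; abel
    | zero => simp
    | add y y' h h' => simp only [map_add, LinearMap.add_apply, h, h']; abel
  | zero => simp
  | add x x' h h' => simp only [map_add, LinearMap.add_apply, h, h']; abel

instance : Bracket HVAlgebra HVAlgebra := ⟨fun x y => bracketBilin x y⟩

/-- The twisted Heisenberg–Virasoro algebra as a Lie ring. -/
instance : LieRing HVAlgebra where
  add_lie x y z := by
    change bracketBilin (x + y) z = bracketBilin x z + bracketBilin y z
    simp
  lie_add x y z := by
    change bracketBilin x (y + z) = bracketBilin x y + bracketBilin x z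
    simp
  lie_self x := by
    change bracketBilin x x = 0
    have h : (2 : ℂ) • bracketBilin x x = 0 := by
      rw [two_smul]
      nth_rewrite 1 [bracketBilin_swap x x]
      exact neg_add_cancel _
    exact (smul_eq_zero.mp h).resolve_left two_ne_zero
  leibniz_lie x y z := bracketBilin_jacobi x y z

/-- The twisted Heisenberg–Virasoro algebra as a complex Lie algebra. -/
instance : LieAlgebra ℂ HVAlgebra where
  lie_smul c x y := by
    change bracketBilin x (c • y) = c • bracketBilin x y
    simp

theorem lie_d_d (n m : ℤ) : ⁅d n, d m⁆ = ((m : ℂ) - n) • d (m + n) +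
    (if n = -m then ((n : ℂ) ^ 3 - n) / 12 else 0) • z1 := bracketBilin_basis _ _

theorem lie_d_I (n m : ℤ) : ⁅d n, I m⁆ = (m : ℂ) • I (m + n) +
    (if n = -m then (n : ℂ) ^ 2 + n else 0) • z2 := bracketBilin_basis _ _

theorem lie_I_I (n m : ℤ) : ⁅I n, I m⁆ = (if n = -m then (n : ℂ) else 0) • z3 :=
  bracketBilin_basis _ _

theorem lie_z1 (x : HVAlgebra) : ⁅x, z1⁆ = 0 := bracketBilin_z1 x

theorem lie_z2 (x : HVAlgebra) : ⁅x, z2⁆ = 0 := bracketBilin_z2 x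

theorem lie_z3 (x : HVAlgebra) : ⁅x, z3⁆ = 0 := bracketBilin_z3 x

theorem z3_lie (x : HVAlgebra) : ⁅z3, x⁆ = 0 := bracketBilin_z3_left x

/-- The Heisenberg subalgebra, with basis `I_n (n ∈ ℤ), z_3`. -/
def heisenberg : LieSubalgebra ℂ HVAlgebra where
  toSubmodule := Submodule.span ℂ (Set.range I ∪ {z3})
  lie_mem' := by
    intro x y hx hy
    simp only [AddSubsemigroup.mem_carrier, AddSubmonoid.mem_toSubsemigroup,
      Submodule.mem_toAddSubmonoid] at hx hy ⊢
    induction hx, hy using Submodule.span_induction₂ with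
    | mem_mem x y hx hy =>
      rcases hx with ⟨n, rfl⟩ | rfl
      · rcases hy with ⟨m, rfl⟩ | rfl
        · rw [lie_I_I]
          exact Submodule.smul_mem _ _ (Submodule.subset_span (Or.inr rfl))
        · rw [lie_z3]
          exact Submodule.zero_mem _
      · rw [z3_lie]
        exact Submodule.zero_mem _
    | zero_left y hy => simp
    | zero_right x hx => simp
    | add_left x y z _ _ _ h₁ h₂ => rw [add_lie]; exact Submodule.add_mem _ h₁ h₂
    | add_right x y z _ _ _ h₁ h₂ => rw [lie_add]; exact Submodule.add_mem _ h₁ h₂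
    | smul_left r x y _ _ h => rw [smul_lie]; exact Submodule.smul_mem _ _ h
    | smul_right r x y _ _ h => rw [lie_smul]; exact Submodule.smul_mem _ _ h

namespace heisenberg

/-- `I_n` as an element of the Heisenberg subalgebra. -/
def I (n : ℤ) : heisenberg :=
  ⟨HVAlgebra.I n, Submodule.subset_span (Or.inl ⟨n, rfl⟩)⟩

/-- `z_3` as an element of the Heisenberg subalgebra. -/
def z3 : heisenberg :=
  ⟨HVAlgebra.z3, Submodule.subset_span (Or.inr rfl)⟩

/-- The homogeneous components of the Heisenberg algebra: `ℂ I_n` in degree `n ≠ 0` and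
`ℂ I_0 + ℂ z_3` in degree `0`. -/
def component (n : ℤ) : Submodule ℂ heisenberg :=
  if n = 0 then Submodule.span ℂ {I 0, z3} else Submodule.span ℂ {I n}

end heisenberg

/-- Condition A for a module `V` over a Lie algebra `L` with homogeneous components `L_i`
(`i ∈ ℤ`): each `v ∈ V` is annihilated by all `L_i` with `i ≥ n`, for some positive integer `n`
depending on `v`. The category `𝒪_L` is the category of the modules with this property. -/
def ConditionA {L : Type*} [LieRing L] [LieAlgebra ℂ L] (component : ℤ → Submodule ℂ L)
    (V : Type*) [AddCommGroup V] [Module ℂ V] [LieRingModule L V] [LieModule ℂ L V] : Prop :=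
  ∀ v : V, ∃ n : ℤ, 0 < n ∧ ∀ i : ℤ, n ≤ i → ∀ x ∈ component i, ⁅x, v⁆ = 0

/-- The normally ordered product `:A_i A_j:` of two members of a family of operators: the factor
with the smaller index stands on the left. -/
def normalOrder {V : Type*} [AddCommGroup V] [Module ℂ V] (A : ℤ → Module.End ℂ V)
    (i j : ℤ) : Module.End ℂ V :=
  if i < j then A i * A j else A j * A i

end

end HVAlgebra

/-!
The theorem is the Sugawara construction. The operators `I_n` form an oscillator family of nonzero
level: `[A_n, A_m] = n δ_{n,-m} c`, and every vector is killed by `A_n` for large `n`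
(`HVAlgebra.IsOscillator`, `HVAlgebra.isOscillator_of_conditionA`).

Normal ordering puts the larger index on the right, so on a given vector only finitely many terms
of `S_k = ∑_i :A_{-i} A_{i+k}:` are nonzero (`IsOscillator.finite_normalOrder`). Since
`:A_a A_b:` differs from `A_a A_b` by a scalar, commutators with `A_j` are computed termwise and
give `[S_k, A_j] = -2cj A_{j+k}` (`IsOscillator.sugawara_mul`). Hence `[S_n, :A_a A_b:]` is
`-2c (a :A_{a+n} A_b: + b :A_a A_{b+n}: + const)`, where the constant comes from restoring normal
order and vanishes unless `a + b + n = 0` and `a`, `b` have the same sign. Summing over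
`a = -i`, `b = i + m`, the quadratic terms recombine to `(m - n) S_{m+n}` after a shift of the
summation index, and the constants add up to `c ∑_{0<i<m} i (m - i) = c (m³ - m) / 6`
(`finsum_reorderWeight`). This is `IsOscillator.sugawara_mul_sugawara`: the operators
`-S_k / (2c)` satisfy the Virasoro relations with central charge `1`.

Adding `((k + 1) c₂ / c) A_k` creates the `z_2` cocycle in `[d_n, I_m]` and changes the central
charge to `1 - 12 c₂² / c` (`virasoro_mul`, `virasoro_mul_virasoro`). These relations say that
the linear map prescribed on the basis is a Lie algebra homomorphism
(`IsOscillator.representation`). It is unique because its values on a basis are prescribed.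
-/

namespace HVAlgebra

noncomputable section

variable {V : Type*} [AddCommGroup V] [Module ℂ V]

/-! ### Oscillator families and normal ordering -/

/-- A family of operators `A n`, `n ∈ ℤ`, forms an oscillator representation of level `c` if
`[A n, A m] = n δ_{n,-m} c` and every vector is annihilated by `A n` for all large `n`. -/
structure IsOscillator (A : ℤ → Module.End ℂ V) (c : ℂ) : Prop where
  comm : ∀ n m, A n * A m = A m * A n + (if n = -m then (n : ℂ) * c else 0) • 1
  locallyFinite : ∀ v, ∃ N : ℤ, ∀ i, N ≤ i → A i v = 0

theorem normalOrder_swap (A : ℤ → Module.End ℂ V) (i j : ℤ) :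
    normalOrder A i j = normalOrder A j i := by
  unfold normalOrder
  rcases lt_trichotomy i j with h | rfl | h
  · simp [h, h.not_gt]
  · rfl
  · simp [h, h.not_gt]

/-- The weight of the constant that appears when the commutator of the Sugawara operator of
degree `-(a + b)` with `:A_a A_b:` is put into normal order: `ab` if `a, b > 0`, `-ab` if
`a, b < 0`, and `0` otherwise. -/
def reorderWeight (a b : ℤ) : ℤ := max a 0 * max b 0 - max (-a) 0 * max (-b) 0

theorem reorderWeight_swap (a b : ℤ) : reorderWeight a b = reorderWeight b a := by
  unfold reorderWeight; ring

theorem mul_max_add_mul_max {a b : ℤ} (h : a ≤ b) :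
    a * max (-b) 0 + b * max a 0 = reorderWeight a b := by
  unfold reorderWeight
  rcases le_total a 0 with ha | ha <;> rcases le_total b 0 with hb | hb
  · simp [ha, hb]
  · simp [ha, hb]
  · simp [show a = 0 by omega, hb]
  · simp [ha, hb, mul_comm]

namespace IsOscillator

variable {A : ℤ → Module.End ℂ V} {c : ℂ}

/-- Normal ordering changes a product of two oscillators by a scalar only, so it is invisible to
commutators. -/
theorem mul_eq_normalOrder (hA : IsOscillator A c) (a b : ℤ) :
    A a * A b = normalOrder A a b + (if a + b = 0 then ((max a 0 : ℤ) : ℂ) * c else 0) • 1 := by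
  unfold normalOrder
  by_cases h : a < b
  · by_cases h0 : a + b = 0
    · simp [h, h0, max_eq_right (show a ≤ 0 by omega)]
    · simp [h, h0]
  · rw [if_neg h, hA.comm a b]
    by_cases h0 : a + b = 0
    · simp [show a = -b by omega, max_eq_left (show 0 ≤ -b by omega)]
    · simp [h0, show a ≠ -b by omega]

/-- The larger index tends to `+∞` as `|i| → ∞`, and the operator carrying it acts first. -/
theorem finite_normalOrder (hA : IsOscillator A c) (p q : ℤ) (v : V) :
    {i : ℤ | normalOrder A (p - i) (i + q) v ≠ 0}.Finite := by
  obtain ⟨N, hN⟩ := hA.locallyFinite v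
  refine (Set.finite_Icc (p - N) (N - q)).subset fun i hi => ?_
  by_contra h
  apply hi
  have h' : N ≤ max (p - i) (i + q) := by
    simp only [Set.mem_Icc] at h
    omega
  unfold normalOrder
  split_ifs with hlt
  · rw [Module.End.mul_apply, hN _ (by omega), map_zero]
  · rw [Module.End.mul_apply, hN _ (by omega), map_zero]

theorem finite_normalOrder_neg (hA : IsOscillator A c) (k : ℤ) (v : V) :
    {i : ℤ | normalOrder A (-i) (i + k) v ≠ 0}.Finite := by
  simpa using hA.finite_normalOrder 0 k v

/-! ### Sugawara operators -/

/-- The quadratic Sugawara operator `∑_i :A_{-i} A_{i+k}:`, a locally finite sum. -/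
def sugawara (hA : IsOscillator A c) (k : ℤ) : Module.End ℂ V where
  toFun v := ∑ᶠ i : ℤ, normalOrder A (-i) (i + k) v
  map_add' v w := by
    simp only [map_add]
    exact finsum_add_distrib (hA.finite_normalOrder_neg k v) (hA.finite_normalOrder_neg k w)
  map_smul' r v := by
    simp only [map_smul, RingHom.id_apply]
    exact (smul_finsum r _).symm

theorem sugawara_apply (hA : IsOscillator A c) (k : ℤ) (v : V) :
    hA.sugawara k v = ∑ᶠ i : ℤ, normalOrder A (-i) (i + k) v := rfl

/-- Only the terms `i = -(j + k)` and `i = j` of the Sugawara operator fail to commute with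
`A j`. -/
theorem normalOrder_mul (hA : IsOscillator A c) (k i j : ℤ) :
    normalOrder A (-i) (i + k) * A j = A j * normalOrder A (-i) (i + k) -
      ((if i = -(j + k) then (j : ℂ) * c else 0) • A (j + k) +
        (if i = j then (j : ℂ) * c else 0) • A (j + k)) := by
  have h := hA.mul_eq_normalOrder (-i) (i + k)
  rw [← sub_eq_iff_eq_add] at h
  have h₁ := hA.comm (i + k) j
  have h₂ := hA.comm (-i) j
  have e₁ : (if i + k = -j then ((i + k : ℤ) : ℂ) * c else 0) • A (-i) =
      -((if i = -(j + k) then (j : ℂ) * c else 0) • A (j + k)) := by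
    by_cases hi : i = -(j + k)
    · subst hi; simp
    · rw [if_neg hi, if_neg (show i + k ≠ -j by omega), zero_smul, zero_smul, neg_zero]
  have e₂ : (if -i = -j then ((-i : ℤ) : ℂ) * c else 0) • A (i + k) =
      -((if i = j then (j : ℂ) * c else 0) • A (j + k)) := by
    by_cases hi : i = j
    · subst hi; simp
    · simp [hi]
  have h₃ : A (-i) * A (i + k) * A j = A j * (A (-i) * A (i + k)) +
      ((if i + k = -j then ((i + k : ℤ) : ℂ) * c else 0) • A (-i) +
        (if -i = -j then ((-i : ℤ) : ℂ) * c else 0) • A (i + k)) := by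
    rw [mul_assoc, h₁, mul_add, ← mul_assoc, h₂, add_mul, mul_smul_comm, mul_one,
      smul_mul_assoc, one_mul, mul_assoc]
    abel
  rw [← h, sub_mul, mul_sub, h₃, e₁, e₂, smul_mul_assoc, mul_smul_comm, one_mul, mul_one]
  abel

/-- The Sugawara operators act on the oscillators as derivations: `[S_k, A_j] = -2cj A_{j+k}`. -/
theorem sugawara_mul (hA : IsOscillator A c) (k j : ℤ) :
    hA.sugawara k * A j = A j * hA.sugawara k - (2 * c * j) • A (j + k) := by
  ext v
  -- On `v` the commutator of each term is a sum of two families supported at a single index.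
  have hs : ∀ i₀ : ℤ, (Function.support fun i : ℤ =>
      (if i = i₀ then (j : ℂ) * c else 0) • A (j + k) v).Finite := fun i₀ =>
    (Set.finite_singleton i₀).subset fun i hi => by
      by_contra h
      exact hi (by simp [show i ≠ i₀ from h])
  have hv : ∀ i₀ : ℤ, ∑ᶠ i : ℤ, (if i = i₀ then (j : ℂ) * c else 0) • A (j + k) v =
      ((j : ℂ) * c) • A (j + k) v := fun i₀ => by
    rw [finsum_eq_single _ i₀ fun i hi => by simp [hi]]
    simp
  have hf : (Function.support fun i : ℤ => A j (normalOrder A (-i) (i + k) v)).Finite :=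
    (hA.finite_normalOrder_neg k v).subset fun i hi h => hi (by simp [h])
  simp only [Module.End.mul_apply, LinearMap.sub_apply, LinearMap.smul_apply, sugawara_apply]
  rw [map_finsum _ (hA.finite_normalOrder_neg k v)]
  have key : ∀ i : ℤ, normalOrder A (-i) (i + k) (A j v) = A j (normalOrder A (-i) (i + k) v) -
      ((if i = -(j + k) then (j : ℂ) * c else 0) • A (j + k) v +
        (if i = j then (j : ℂ) * c else 0) • A (j + k) v) := fun i =>
    congrArg (fun f : Module.End ℂ V => f v) (hA.normalOrder_mul k i j)
  simp only [key]
  rw [finsum_sub_distrib hf (((hs _).union (hs _)).subset (Function.support_add _ _)),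
    finsum_add_distrib (hs _) (hs _), hv, hv]
  module

/-- The commutator of `sugawara n` with a product of two oscillators, without normal ordering. -/
theorem sugawara_mul_mul (hA : IsOscillator A c) (n a b : ℤ) :
    hA.sugawara n * (A a * A b) = A a * A b * hA.sugawara n -
      (2 * c) • ((a : ℂ) • (A (a + n) * A b) + (b : ℂ) • (A a * A (b + n))) := by
  rw [← mul_assoc, sugawara_mul, sub_mul, mul_assoc, sugawara_mul, mul_sub, smul_mul_assoc,
    mul_smul_comm, ← mul_assoc]
  module

/-- The two quadratic terms of the commutator, put back into normal order; only this step produces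
a constant. -/
theorem sugawara_mul_normalOrder (hA : IsOscillator A c) (n a b : ℤ) :
    hA.sugawara n * normalOrder A a b = normalOrder A a b * hA.sugawara n -
      (2 * c) • ((a : ℂ) • normalOrder A (a + n) b + (b : ℂ) • normalOrder A a (b + n) +
        (if a + b + n = 0 then (reorderWeight a b : ℂ) * c else 0) • 1) := by
  -- For `a ≤ b` the product `A a * A b` differs from `:A_a A_b:` by a scalar, and all terms are
  -- symmetric in `a` and `b`.
  wlog hab : a ≤ b generalizing a b
  · rw [normalOrder_swap A a b, this b a (by omega), normalOrder_swap A (b + n) a,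
      normalOrder_swap A b (a + n), reorderWeight_swap b a, add_comm b a,
      add_comm ((b : ℂ) • _)]
  have h := hA.mul_eq_normalOrder a b
  rw [← sub_eq_iff_eq_add] at h
  rw [← h, mul_sub, sub_mul, sugawara_mul_mul, hA.mul_eq_normalOrder (a + n) b,
    hA.mul_eq_normalOrder a (b + n), smul_mul_assoc, mul_smul_comm, one_mul, mul_one,
    ← mul_max_add_mul_max hab, show a + n + b = a + b + n by ring,
    show a + (b + n) = a + b + n by ring]
  by_cases h0 : a + b + n = 0
  · simp only [h0, if_true, show a + n = -b by omega]
    push_cast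
    module
  · simp only [h0, if_false]
    module

/-! ### The central charge -/

end IsOscillator

theorem sum_range_mul_sub (p : ℕ) :
    6 * ∑ i ∈ Finset.range p, (i : ℤ) * (p - i) = (p : ℤ) ^ 3 - p := by
  have h : ∀ (x : ℤ) (q : ℕ), 6 * ∑ i ∈ Finset.range q, (i : ℤ) * (x - i) =
      3 * x * (q * (q - 1)) - q * (q - 1) * (2 * q - 1) := fun x q => by
    induction q with
    | zero => simp
    | succ q ih =>
      rw [Finset.sum_range_succ, mul_add, ih]
      push_cast
      ring
  rw [h]
  ring

theorem reorderWeight_support_subset (m : ℤ) :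
    (Function.support fun i : ℤ => reorderWeight (-i) (i + m)) ⊆
      Finset.Icc (-|m|) |m| := fun i hi => by
  by_contra h
  apply hi
  have h' : i < -|m| ∨ |m| < i := by
    simp only [Finset.coe_Icc, Set.mem_Icc] at h
    omega
  have := neg_abs_le m
  have := le_abs_self m
  rcases h' with h' | h'
  · simp [reorderWeight, max_eq_right (show i + m ≤ 0 by omega),
      max_eq_right (show i ≤ 0 by omega)]
  · simp only [reorderWeight, neg_neg, max_eq_right (show -i ≤ 0 by omega),
      max_eq_right (show -(i + m) ≤ 0 by omega), zero_mul, mul_zero, sub_zero]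

theorem finsum_reorderWeight_natCast (p : ℕ) :
    6 * ∑ᶠ i : ℤ, reorderWeight (-i) (i + p) = (p : ℤ) ^ 3 - p := by
  rw [← sum_range_mul_sub, ← finsum_comp_equiv (Equiv.neg ℤ)]
  have hs : (Function.support fun i : ℤ => reorderWeight (- -i) (-i + p)) ⊆
      ((Finset.range p).map Nat.castEmbedding : Finset ℤ) := fun i hi => by
    by_contra h
    apply hi
    have h' : i < 0 ∨ (p : ℤ) ≤ i := by
      by_contra! h'
      exact h (by simpa using ⟨i.toNat, by omega, by omega⟩)
    rcases h' with h' | h'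
    · simp [reorderWeight, max_eq_right (show i ≤ 0 by omega),
        max_eq_right (show -(p : ℤ) + i ≤ 0 by omega)]
    · simp [reorderWeight, max_eq_right (show -i ≤ 0 by omega),
        max_eq_right (show -i + (p : ℤ) ≤ 0 by omega)]
  simp only [Equiv.neg_apply]
  rw [finsum_eq_sum_of_support_subset _ hs, Finset.sum_map]
  congr 1
  refine Finset.sum_congr rfl fun i hi => ?_
  have := Finset.mem_range.1 hi
  simp only [Nat.castEmbedding_apply, reorderWeight, neg_neg]
  rw [max_eq_left (show (0 : ℤ) ≤ i by omega), max_eq_left (show 0 ≤ -(i : ℤ) + p by omega),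
    max_eq_right (show -(i : ℤ) ≤ 0 by omega)]
  ring

/-- The sum of the reordering constants, which is the source of the cubic cocycle. For `m ≥ 0` it
is `∑_{0 < i < m} i (m - i)`, and it is odd in `m`. -/
theorem finsum_reorderWeight (m : ℤ) :
    6 * ∑ᶠ i : ℤ, reorderWeight (-i) (i + m) = m ^ 3 - m := by
  obtain ⟨p, rfl | rfl⟩ := m.eq_nat_or_neg
  · exact finsum_reorderWeight_natCast p
  · have h := finsum_reorderWeight_natCast p
    rw [← finsum_comp_equiv (Equiv.neg ℤ)] at h
    have e : ∀ i : ℤ, reorderWeight (-i) (i + -p) =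
        -reorderWeight (-(Equiv.neg ℤ i)) (Equiv.neg ℤ i + p) := fun i => by
      simp only [Equiv.neg_apply, reorderWeight, neg_neg, neg_add, neg_sub]
    simp only [e, finsum_neg_distrib]
    linear_combination -h

theorem finsum_reorderWeight_cast (m : ℤ) :
    ∑ᶠ i : ℤ, (reorderWeight (-i) (i + m) : ℂ) = ((m : ℂ) ^ 3 - m) / 6 := by
  have hf : (Function.support fun i : ℤ => reorderWeight (-i) (i + m)).Finite :=
    (Finset.finite_toSet _).subset (reorderWeight_support_subset m)
  have h : ((∑ᶠ i : ℤ, reorderWeight (-i) (i + m) : ℤ) : ℂ) =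
      ∑ᶠ i : ℤ, (reorderWeight (-i) (i + m) : ℂ) :=
    (Int.castAddHom ℂ).map_finsum hf
  have h₂ := congrArg (Int.cast : ℤ → ℂ) (finsum_reorderWeight m)
  push_cast at h₂
  rw [← h, eq_div_iff (by norm_num), ← h₂, mul_comm]

namespace IsOscillator

variable {A : ℤ → Module.End ℂ V} {c : ℂ}

/-- The Sugawara operators satisfy the Virasoro relations up to scaling. The commutator is taken
termwise in the sum defining `sugawara m`; the three resulting families are each locally finite,
so the first one may be shifted separately and the quadratic terms recombine to
`sugawara (m + n)`. -/
theorem sugawara_mul_sugawara (hA : IsOscillator A c) (n m : ℤ) :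
    hA.sugawara n * hA.sugawara m = hA.sugawara m * hA.sugawara n -
      (2 * c) • (((m : ℂ) - n) • hA.sugawara (m + n) +
        (if n = -m then ((m : ℂ) ^ 3 - m) / 6 * c else 0) • 1) := by
  ext v
  simp only [Module.End.mul_apply, LinearMap.sub_apply, LinearMap.smul_apply,
    LinearMap.add_apply, Module.End.one_apply]
  rw [hA.sugawara_apply m v, hA.sugawara_apply m (hA.sugawara n v),
    map_finsum _ (hA.finite_normalOrder_neg m v)]
  have key : ∀ i : ℤ, hA.sugawara n (normalOrder A (-i) (i + m) v) =
      normalOrder A (-i) (i + m) (hA.sugawara n v) -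
      (2 * c) • (((-i : ℤ) : ℂ) • normalOrder A (n - i) (i + m) v +
        ((i + m : ℤ) : ℂ) • normalOrder A (-i) (i + (m + n)) v +
        ((reorderWeight (-i) (i + m) : ℂ) * (if n = -m then c else 0)) • v) := fun i => by
    have h := congrArg (fun f : Module.End ℂ V => f v)
      (hA.sugawara_mul_normalOrder n (-i) (i + m))
    simp only [Module.End.mul_apply, LinearMap.sub_apply, LinearMap.smul_apply,
      LinearMap.add_apply, Module.End.one_apply] at h
    rw [h, neg_add_eq_sub i n, add_assoc i m n]
    congr 4
    by_cases h0 : n = -m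
    · simp [h0]
    · rw [if_neg h0, if_neg (show -i + (i + m) + n ≠ 0 by omega), mul_zero]
  simp only [key]
  have f₁ : (Function.support fun i : ℤ =>
      ((-i : ℤ) : ℂ) • normalOrder A (n - i) (i + m) v).Finite :=
    (hA.finite_normalOrder n m v).subset fun i hi h => hi (by simp [h])
  have f₂ : (Function.support fun i : ℤ =>
      ((i + m : ℤ) : ℂ) • normalOrder A (-i) (i + (m + n)) v).Finite :=
    (hA.finite_normalOrder_neg (m + n) v).subset fun i hi h => hi (by simp [h])
  have f₃ : (Function.support fun i : ℤ =>
      ((reorderWeight (-i) (i + m) : ℂ) * (if n = -m then c else 0)) • v).Finite :=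
    ((Finset.finite_toSet _).subset (reorderWeight_support_subset m)).subset
      fun i hi h => hi (by simp [h])
  have f₁₂ := (f₁.union f₂).subset (Function.support_add _ _)
  have f₁₂₃ := (f₁₂.union f₃).subset (Function.support_add _ _)
  rw [finsum_sub_distrib (hA.finite_normalOrder_neg m _)
      (f₁₂₃.subset fun i hi h => hi (by
        simp only [Pi.add_apply] at h
        simp only [h, smul_zero])),
    ← smul_finsum, finsum_add_distrib f₁₂ f₃, finsum_add_distrib f₁ f₂]
  -- The shift `i ↦ i + n` brings the first family to the same normally ordered products as the
  -- second.
  have s₁ : ∑ᶠ i : ℤ, ((-i : ℤ) : ℂ) • normalOrder A (n - i) (i + m) v =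
      ∑ᶠ i : ℤ, ((-(i + n) : ℤ) : ℂ) • normalOrder A (-i) (i + (m + n)) v := by
    rw [← finsum_comp_equiv (Equiv.addRight n)]
    refine finsum_congr fun i => ?_
    simp only [Equiv.coe_addRight]
    rw [show n - (i + n) = -i by ring, show i + n + m = i + (m + n) by ring]
  have f₁' : (Function.support fun i : ℤ =>
      ((-(i + n) : ℤ) : ℂ) • normalOrder A (-i) (i + (m + n)) v).Finite :=
    (hA.finite_normalOrder_neg (m + n) v).subset fun i hi h => hi (by simp [h])
  have s₁₂ : ∑ᶠ i : ℤ, ((-(i + n) : ℤ) : ℂ) • normalOrder A (-i) (i + (m + n)) v +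
      ∑ᶠ i : ℤ, ((i + m : ℤ) : ℂ) • normalOrder A (-i) (i + (m + n)) v =
      ((m : ℂ) - n) • hA.sugawara (m + n) v := by
    rw [← finsum_add_distrib f₁' f₂, sugawara_apply, smul_finsum]
    refine finsum_congr fun i => ?_
    push_cast
    module
  have s₃ : ∑ᶠ i : ℤ, ((reorderWeight (-i) (i + m) : ℂ) * (if n = -m then c else 0)) • v =
      (if n = -m then ((m : ℂ) ^ 3 - m) / 6 * c else 0) • v := by
    rw [← finsum_smul, ← finsum_mul, finsum_reorderWeight_cast]
    split_ifs <;> simp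
  rw [s₁, s₁₂, s₃]

/-! ### Virasoro operators and the representation -/

/-- The operator by which `d_k` acts: the rescaled Sugawara operator plus a linear correction,
which accounts for the action of `z_2` and shifts the central charge from `1` to
`1 - 12 c₂² / c`. -/
def virasoro (hA : IsOscillator A c) (c₂ : ℂ) (k : ℤ) : Module.End ℂ V :=
  -(1 / (2 * c)) • hA.sugawara k + (((k : ℂ) + 1) * c₂ / c) • A k

theorem virasoro_mul (hA : IsOscillator A c) (hc : c ≠ 0) (c₂ : ℂ) (n m : ℤ) :
    hA.virasoro c₂ n * A m = A m * hA.virasoro c₂ n + ((m : ℂ) • A (m + n) +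
      (if n = -m then (n : ℂ) ^ 2 + n else 0) • c₂ • 1) := by
  simp only [virasoro, add_mul, mul_add, smul_mul_assoc, mul_smul_comm, sugawara_mul,
    hA.comm n m]
  by_cases h : n = -m
  · simp only [h, if_true]
    match_scalars <;> field_simp
    ring
  · simp only [h, if_false]
    match_scalars <;> field_simp
    ring

theorem virasoro_mul_virasoro (hA : IsOscillator A c) (hc : c ≠ 0) (c₂ : ℂ) (n m : ℤ) :
    hA.virasoro c₂ n * hA.virasoro c₂ m = hA.virasoro c₂ m * hA.virasoro c₂ n +
      (((m : ℂ) - n) • hA.virasoro c₂ (m + n) +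
        (if n = -m then ((n : ℂ) ^ 3 - n) / 12 else 0) • (1 - 12 * c₂ ^ 2 / c) • 1) := by
  simp only [virasoro, add_mul, mul_add, smul_mul_assoc, mul_smul_comm, sugawara_mul,
    hA.comm n m, hA.sugawara_mul_sugawara n m, add_comm n m]
  by_cases h : n = -m
  · subst h
    simp only [if_true]
    push_cast
    match_scalars <;> field_simp <;> ring
  · simp only [h, if_false]
    push_cast
    match_scalars <;> field_simp <;> ring

/-- The images of the basis vectors of the twisted Heisenberg–Virasoro algebra. -/
def basisImage (hA : IsOscillator A c) (c₂ : ℂ) : HVIndex → Module.End ℂ V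
  | .d k => hA.virasoro c₂ k
  | .I k => A k
  | .z1 => (1 - 12 * c₂ ^ 2 / c) • 1
  | .z2 => c₂ • 1
  | .z3 => c • 1

/-- The linear extension of `basisImage`. -/
def extension (hA : IsOscillator A c) (c₂ : ℂ) : HVAlgebra →ₗ[ℂ] Module.End ℂ V :=
  basis.constr ℂ (hA.basisImage c₂)

theorem extension_basis (hA : IsOscillator A c) (c₂ : ℂ) (a : HVIndex) :
    hA.extension c₂ (basis a) = hA.basisImage c₂ a := by
  simp [extension]

theorem extension_d (hA : IsOscillator A c) (c₂ : ℂ) (k : ℤ) :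
    hA.extension c₂ (d k) = hA.virasoro c₂ k := hA.extension_basis c₂ _

theorem extension_I (hA : IsOscillator A c) (c₂ : ℂ) (k : ℤ) :
    hA.extension c₂ (I k) = A k := hA.extension_basis c₂ _

theorem extension_z1 (hA : IsOscillator A c) (c₂ : ℂ) :
    hA.extension c₂ z1 = (1 - 12 * c₂ ^ 2 / c) • 1 := hA.extension_basis c₂ _

theorem extension_z2 (hA : IsOscillator A c) (c₂ : ℂ) :
    hA.extension c₂ z2 = c₂ • 1 := hA.extension_basis c₂ _

theorem extension_z3 (hA : IsOscillator A c) (c₂ : ℂ) :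
    hA.extension c₂ z3 = c • 1 := hA.extension_basis c₂ _

theorem extension_basisBracket (hA : IsOscillator A c) (hc : c ≠ 0) (c₂ : ℂ) (a b : HVIndex) :
    hA.extension c₂ (basisBracket a b) =
      hA.basisImage c₂ a * hA.basisImage c₂ b - hA.basisImage c₂ b * hA.basisImage c₂ a := by
  cases a <;> cases b <;>
    simp only [basisBracket, basisImage, map_add, map_neg, map_smul, map_zero, extension_d,
      extension_I, extension_z1, extension_z2, extension_z3, smul_mul_assoc, mul_smul_comm,
      one_mul, mul_one, sub_self]
  case d.d n m => rw [hA.virasoro_mul_virasoro hc c₂ n m]; abel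
  case d.I n m => rw [hA.virasoro_mul hc c₂ n m]; abel
  case I.d m n => rw [hA.virasoro_mul hc c₂ n m]; abel
  case I.I n m =>
    rw [hA.comm n m, add_sub_cancel_left]
    split_ifs <;> module
  all_goals first | rfl | module

/-- The representation of the twisted Heisenberg–Virasoro algebra attached to an oscillator
representation of nonzero level. -/
def representation (hA : IsOscillator A c) (hc : c ≠ 0) (c₂ : ℂ) :
    HVAlgebra →ₗ⁅ℂ⁆ Module.End ℂ V :=
  { hA.extension c₂ with
    map_lie' := by
      intro x y
      change hA.extension c₂ (bracketBilin x y) =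
        hA.extension c₂ x * hA.extension c₂ y - hA.extension c₂ y * hA.extension c₂ x
      have h : bracketBilin.compr₂ (hA.extension c₂) =
          (LinearMap.mul ℂ (Module.End ℂ V)).compl₁₂ (hA.extension c₂) (hA.extension c₂) -
          ((LinearMap.mul ℂ (Module.End ℂ V)).compl₁₂
            (hA.extension c₂) (hA.extension c₂)).flip := by
        refine basis.ext fun a => basis.ext fun b => ?_
        simpa [bracketBilin_basis, extension_basis] using hA.extension_basisBracket hc c₂ a b
      simpa using congrArg (fun f => f x y) h }

theorem representation_apply (hA : IsOscillator A c) (hc : c ≠ 0) (c₂ : ℂ) (x : HVAlgebra) :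
    hA.representation hc c₂ x = hA.extension c₂ x := rfl

end IsOscillator

/-- A Heisenberg module in `𝒪_ℋ` on which `z_3` acts as `c` is an oscillator representation of
level `c`. -/
theorem isOscillator_of_conditionA {H : Type*} [AddCommGroup H] [Module ℂ H]
    [LieRingModule heisenberg H] [LieModule ℂ heisenberg H] {c : ℂ}
    (hA : ConditionA heisenberg.component H) (hz₃ : ∀ v : H, ⁅heisenberg.z3, v⁆ = c • v) :
    IsOscillator (fun j => LieModule.toEnd ℂ heisenberg H (heisenberg.I j)) c where
  comm n m := by
    have h : ⁅heisenberg.I n, heisenberg.I m⁆ =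
        (if n = -m then (n : ℂ) else 0) • heisenberg.z3 := Subtype.ext (lie_I_I n m)
    ext v
    have h' := lie_lie (heisenberg.I n) (heisenberg.I m) v
    rw [h, smul_lie, hz₃, eq_sub_iff_add_eq] at h'
    simp only [Module.End.mul_apply, LinearMap.add_apply, LinearMap.smul_apply,
      Module.End.one_apply, LieModule.toEnd_apply_apply]
    rw [← h', smul_smul, add_comm]
    split_ifs <;> simp
  locallyFinite v := by
    obtain ⟨N, hN, h⟩ := hA v
    refine ⟨N, fun i hi => h i hi _ ?_⟩
    rw [heisenberg.component, if_neg (by omega)]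
    exact Submodule.mem_span_singleton_self _

/-- A linear map on the whole algebra that agrees with the Heisenberg action on the generators
`I_n` and `z_3` agrees with it on the Heisenberg subalgebra. -/
theorem eq_lie_of_generators {H : Type*} [AddCommGroup H] [Module ℂ H]
    [LieRingModule heisenberg H] [LieModule ℂ heisenberg H] (f : HVAlgebra →ₗ[ℂ] Module.End ℂ H)
    (hI : ∀ n v, f (I n) v = ⁅heisenberg.I n, v⁆) (h3 : ∀ v, f z3 v = ⁅heisenberg.z3, v⁆)
    (x : heisenberg) (v : H) : f x v = ⁅x, v⁆ := by
  obtain ⟨x, hx⟩ := x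
  induction hx using Submodule.span_induction with
  | mem x h =>
    rcases h with ⟨n, rfl⟩ | rfl
    · exact hI n v
    · exact h3 v
  | zero =>
    change f 0 v = ⁅(0 : heisenberg), v⁆
    simp
  | add x y hx hy ihx ihy =>
    change f (x + y) v = ⁅(⟨x, hx⟩ + ⟨y, hy⟩ : heisenberg), v⁆
    rw [add_lie, ← ihx, ← ihy, map_add, LinearMap.add_apply]
  | smul r x hx ih =>
    change f (r • x) v = ⁅r • (⟨x, hx⟩ : heisenberg), v⁆
    rw [smul_lie, ← ih, map_smul, LinearMap.smul_apply]

end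

end HVAlgebra

theorem mainTheorem3 (c₂ c₃ : ℂ) (hc₃ : c₃ ≠ 0)
    (H : Type*) [AddCommGroup H] [Module ℂ H]
    [LieRingModule HVAlgebra.heisenberg H] [LieModule ℂ HVAlgebra.heisenberg H]
    [LieModule.IsIrreducible ℂ HVAlgebra.heisenberg H]
    (hA : HVAlgebra.ConditionA HVAlgebra.heisenberg.component H)
    (hz₃ : ∀ v : H, ⁅HVAlgebra.heisenberg.z3, v⁆ = c₃ • v) :
    -- the sum over `i ∈ ℤ` has only finitely many nonzero terms on each vector
    (∀ (k : ℤ) (v : H), {i : ℤ | HVAlgebra.normalOrder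
        (fun j => LieModule.toEnd ℂ HVAlgebra.heisenberg H (HVAlgebra.heisenberg.I j))
        (-i) (i + k) v ≠ 0}.Finite) ∧
    -- the formulas define a representation of the whole algebra that extends the given one
    ∃! ρ : HVAlgebra →ₗ⁅ℂ⁆ Module.End ℂ H,
      (∀ (x : HVAlgebra.heisenberg) (v : H), ρ (x : HVAlgebra) v = ⁅x, v⁆) ∧
      (∀ v : H, ρ HVAlgebra.z1 v = (1 - 12 * c₂ ^ 2 / c₃) • v) ∧
      (∀ v : H, ρ HVAlgebra.z2 v = c₂ • v) ∧
      (∀ v : H, ρ HVAlgebra.z3 v = c₃ • v) ∧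
      ∀ (k : ℤ) (v : H), ρ (HVAlgebra.d k) v =
        -(1 / (2 * c₃)) • (∑ᶠ i : ℤ, HVAlgebra.normalOrder
          (fun j => LieModule.toEnd ℂ HVAlgebra.heisenberg H (HVAlgebra.heisenberg.I j))
          (-i) (i + k) v) +
        (((k : ℂ) + 1) * c₂ / c₃) • ⁅HVAlgebra.heisenberg.I k, v⁆ := by

  have hosc := HVAlgebra.isOscillator_of_conditionA hA hz₃
  refine ⟨hosc.finite_normalOrder_neg, hosc.representation hc₃ c₂, ⟨?_, ?_, ?_, ?_, ?_⟩, ?_⟩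
  · refine HVAlgebra.eq_lie_of_generators (hosc.extension c₂) (fun n v => ?_) (fun v => ?_)
    · rw [hosc.extension_I]
      rfl
    · rw [hosc.extension_z3, hz₃]
      rfl
  · intro v
    rw [hosc.representation_apply, hosc.extension_z1]
    rfl
  · intro v
    rw [hosc.representation_apply, hosc.extension_z2]
    rfl
  · intro v
    rw [hosc.representation_apply, hosc.extension_z3]
    rfl
  · intro k v
    rw [hosc.representation_apply, hosc.extension_d]
    rfl
  · rintro ρ ⟨hH, h1, h2, h3, hd⟩
    have h : (ρ : HVAlgebra →ₗ[ℂ] Module.End ℂ H) = hosc.extension c₂ := by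
      refine HVAlgebra.basis.ext fun a => LinearMap.ext fun v => ?_
      rw [hosc.extension_basis]
      cases a with
      | d k => exact hd k v
      | I n => exact hH (HVAlgebra.heisenberg.I n) v
      | z1 => exact h1 v
      | z2 => exact h2 v
      | z3 => exact h3 v
    exact LieHom.ext fun x => congrArg (fun f => f x) h
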